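/- All graphs are finite and undirected. A (not necessarily injective) sum labeling of a graph $G$ without loops is a function $\ell:V(G)\to\{1,2,3,\dots\}$ such that any two distinct vertices $u,v$ are adjacent if and only if $\ell(u)+\ell(v)=\ell(w)$ for some $w\in V(G)$; it is minimal if $\ell(w)=1$ for some $w\in V(G)$. A non-injective sum graph is a graph without loops that has a (not necessarily injective) sum labeling. For $n\ge 2$ let $A_n$ be the graph with loops whose vertex set is $S_n=\{2,3,\dots,n\}\cup\{n+2\}$, where (not necessarily distinct) vertices $i,j$ are adjacent if and only if $i+j\in S_n$. Let $\mathcal C(A_n)$ be the class of all graphs, up to isomorphism, obtained from $A_n$ by choosing, independently for each vertex $v$ with a loop, an integer $k_v\ge 2$, and replacing $v$ (with its loop) by a clique on $k_v$ vertices, each of which is joined to all the neighbours of $v$ other than $v$ (respectively, to all the vertices replacing such a neighbour). Theorem. For every $n\ge 39$, every graph in $\mathcal C(A_n)$ is a non-injective sum graph that has no minimal labeling. In particular, there is an infinite family $(F_n)_{n\ge 39}$ of pairwise non-isomorphic non-injective sum graphs (without loops), with $F_n\in\mathcal C(A_n)$, that have no minimal labeling. -/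

import Mathlib

namespace SumGraphs

universe u v

/-- A (not necessarily injective) sum labeling of a graph without loops: labels are positive
integers, and two distinct vertices are adjacent iff the sum of their labels is a label. -/
structure IsSumLabeling {V : Type u} (G : SimpleGraph V) (l : V → ℕ) : Prop where
  pos : ∀ x, 0 < l x
  adj_iff : ∀ x y, x ≠ y → (G.Adj x y ↔ ∃ z, l z = l x + l y)

/-- A non-injective sum graph (without loops): one with a not necessarily injective
sum labeling. -/
def IsNonInjSumGraph {V : Type u} (G : SimpleGraph V) : Prop :=
  ∃ l : V → ℕ, IsSumLabeling G l

/-- A minimal labeling is a sum labeling that uses the label `1`. -/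
def IsMinimalLabeling {V : Type u} (G : SimpleGraph V) (l : V → ℕ) : Prop :=
  IsSumLabeling G l ∧ ∃ x, l x = 1

/-- An undirected graph in which vertices may carry loops. -/
structure LoopGraph (V : Type u) where
  Adj : V → V → Prop
  symm : ∀ x y, Adj x y → Adj y x

/-- The sum graph with loops induced by a finite set `S` of natural numbers. -/
def inducedLoopGraph (S : Finset ℕ) : LoopGraph {i : ℕ // i ∈ S} where
  Adj i j := (i : ℕ) + (j : ℕ) ∈ S
  symm i j h := by rw [Nat.add_comm]; exact h

/-- The set `{2, 3, …, n, n + 2}`. -/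
def setA (n : ℕ) : Finset ℕ := insert (n + 2) (Finset.Icc 2 n)

/-- The graph `A_n`. -/
def graphA (n : ℕ) : LoopGraph {i : ℕ // i ∈ setA n} := inducedLoopGraph (setA n)

/-- Admissible clique sizes: at least `2` at each looped vertex; a vertex without a loop is
kept as a single vertex. -/
def IsCliqueSize {V : Type u} (G : LoopGraph V) (k : V → ℕ) : Prop :=
  ∀ x, (G.Adj x x → 2 ≤ k x) ∧ (¬ G.Adj x x → k x = 1)

/-- Replace each vertex `x` by `k x` copies. Distinct copies of `x` are adjacent iff `x` has a
loop, and copies of distinct `x`, `y` are adjacent iff `x`, `y` are. -/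
def blowUp {V : Type u} (G : LoopGraph V) (k : V → ℕ) : SimpleGraph (Σ x : V, Fin (k x)) where
  Adj a b := a ≠ b ∧ G.Adj a.1 b.1
  symm := ⟨fun _ _ h => ⟨h.1.symm, G.symm _ _ h.2⟩⟩
  loopless := ⟨fun _ h => h.1 rfl⟩

/-- `H` belongs to `C(G)`: up to isomorphism, `H` arises from `G` by replacing each looped
vertex by a clique of some size at least `2`, chosen independently for each vertex. -/
def InC {V : Type u} {W : Type v} (G : LoopGraph V) (H : SimpleGraph W) : Prop :=
  ∃ k : V → ℕ, IsCliqueSize G k ∧ Nonempty (H ≃g blowUp G k)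

end SumGraphs

/-!
Let `L` be the set of labels of a sum labeling of a graph in `C(A_n)`. Equal labels occur only on
vertices replacing the same vertex of `A_n`, so every label has a class in `A_n`. The largest label
`M` is the one of class `n + 2`; let `M'` be the label of class `n - 1`. If `a` is a label of class
`2`, then adding `a` to a label other than `a`, `M` and `M'` gives a label again, so every label
`y ≠ a` starts a progression `y, y + a, …` inside `L` that ends in `M` or `M'`. In particular, only
two residues modulo `a` are available to the labels other than `a`.

Suppose `1 ∈ L`. A label `b` of class `3` is the difference of a progression `y, y + b, y + 2 * b`
in `L`; as `1`, `b` and these three have at most two residues modulo `a`, it follows that `a ≤ 2`.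
If `a = 1`, then `L` is the union of `[1, M']` and `[M' + d, M]` with `d ≥ 2`, and `d` has class
`3`. Comparing the sums with `d` and `d + 1` of `M' - 1` or, when `M = M' + d`, of the label of
class `n` gives a contradiction. If `a = 2` and `1` is not of class `2`, then `L` consists of
`[1, M']` and of all positive numbers up to `M` with the parity of `M`. Here both `1` and `3` have
class `3`, but adding `1` to `M' - 1` gives a label and adding `3` does not.
-/

namespace SumGraphs

open Finset

theorem exists_prefix_mem_of_injective {α : Type*} {S : Set α} (hS : S.Finite) {u : ℕ → α}
    (hu : u.Injective) (h0 : u 0 ∈ S) : ∃ k, (∀ j ≤ k, u j ∈ S) ∧ u (k + 1) ∉ S := by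
  classical
  have hex : ∃ m, u m ∉ S := by
    by_contra! hall
    exact Set.infinite_range_of_injective hu (hS.subset (Set.range_subset_iff.2 hall))
  obtain ⟨k, hk⟩ : ∃ k, Nat.find hex = k + 1 :=
    Nat.exists_eq_add_one_of_ne_zero fun h => (h ▸ Nat.find_spec hex) h0
  exact ⟨k, fun j hj => not_not.1 (Nat.find_min hex (by omega)), hk ▸ Nat.find_spec hex⟩

theorem exists_add_mem_and_add_add_mem {α : Type*} [Add α] [IsRightCancelAdd α] [DecidableEq α]
    {S : Finset α} {b : α} (h : 2 * #{y ∈ S | y + b ∉ S} < #S) :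
    ∃ y ∈ S, y + b ∈ S ∧ y + b + b ∈ S := by
  by_contra! hS
  have hcover : S ⊆ {y ∈ S | y + b ∉ S} ∪ {y ∈ S | y + b ∈ S ∧ y + b + b ∉ S} := by
    intro y hy
    grind
  have hshift : #{y ∈ S | y + b ∈ S ∧ y + b + b ∉ S} ≤ #{y ∈ S | y + b ∉ S} :=
    card_le_card_of_injOn (· + b) (fun y hy => by grind) (add_left_injective b).injOn
  have := (card_le_card hcover).trans (card_union_le _ _)
  omega

theorem eq_zero_or_two_eq_zero_of_mem_pair {R : Type*} [CommRing R] {s t b y : R}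
    (h1 : 1 = s ∨ 1 = t) (hb : b = s ∨ b = t) (hy : y = s ∨ y = t) (hyb : y + b = s ∨ y + b = t)
    (hybb : y + b + b = s ∨ y + b + b = t) : b = 0 ∨ (2 : R) = 0 := by
  -- If `b ≠ 0`, the progression alternates, so `2 * b = 0`; and `1`, `b` are among `y`, `y + b`.
  grind

theorem mem_setA {n i : ℕ} : i ∈ setA n ↔ i = n + 2 ∨ 2 ≤ i ∧ i ≤ n := by
  simp [setA]

theorem card_setA {n : ℕ} (hn : 1 ≤ n) : #(setA n) = n := by
  rw [setA, card_insert_of_notMem (by simp), Nat.card_Icc]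
  omega

/-- The set `L` of labels of a sum labeling of a graph in `C(A_n)`. The class `f l` of a label `l`
is the vertex of `A_n` that is replaced by the vertices labeled `l`, and `g i` is a choice of a
label of class `i`; a looped vertex of `A_n` may have several labels. -/
structure IsLabelSet (n : ℕ) (L : Finset ℕ) (f g : ℕ → ℕ) : Prop where
  pos : ∀ l ∈ L, 0 < l
  class_mem : ∀ l ∈ L, f l ∈ setA n
  label_mem : ∀ i ∈ setA n, g i ∈ L
  class_label : ∀ i ∈ setA n, f (g i) = i
  add_mem_iff : ∀ l ∈ L, ∀ m ∈ L, l ≠ m → (l + m ∈ L ↔ f l + f m ∈ setA n)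
  eq_of_class_eq : ∀ l ∈ L, ∀ m ∈ L, f l = f m → f l + f l ∉ setA n → l = m
  loop : ∀ l ∈ L, f l + f l ∈ setA n → l + l ∈ L ∨ ∃ m ∈ L, m ≠ l ∧ f m = f l

namespace IsLabelSet

variable {n : ℕ} {L : Finset ℕ} {f g : ℕ → ℕ} {a b y : ℕ}

theorem label_injOn (h : IsLabelSet n L f g) : Set.InjOn g (setA n) :=
  Set.LeftInvOn.injOn h.class_label

theorem ne_label (h : IsLabelSet n L f g) {i : ℕ} (hi : i ∈ setA n) (hne : f y ≠ i) : y ≠ g i := by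
  rintro rfl
  exact hne (h.class_label i hi)

theorem card_le (h : IsLabelSet n L f g) (hn : 1 ≤ n) : n ≤ #L :=
  (card_setA hn).ge.trans (card_le_card_of_injOn g h.label_mem h.label_injOn)

theorem eq_label_of_class_eq (h : IsLabelSet n L f g) {i : ℕ} (hy : y ∈ L) (hf : f y = i)
    (hi : n + 2 < i + i) : y = g i := by
  subst hf
  have hmem := h.class_mem y hy
  refine h.eq_of_class_eq y hy _ (h.label_mem _ hmem) (h.class_label _ hmem).symm ?_
  rw [mem_setA]
  omega

theorem le_label_top (h : IsLabelSet n L f g) (hn : 12 ≤ n) (hy : y ∈ L) : y ≤ g (n + 2) := by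
  obtain ⟨m, hm, hmax⟩ := L.exists_max_image id ⟨y, hy⟩
  have hisolated : ∀ i ∈ setA n, i ≠ f m → f m + i ∉ setA n := by
    intro i hi him hadj
    have hne : m ≠ g i := fun e => him (by rw [e, h.class_label i hi])
    have hsum := (h.add_mem_iff m hm _ (h.label_mem i hi) hne).2 (by rwa [h.class_label i hi])
    have hle := hmax _ hsum
    have hpos := h.pos _ (h.label_mem i hi)
    simp only [id] at hle
    omega
  have hclass : f m = n + 2 := by
    have hfm := mem_setA.1 (h.class_mem m hm)
    simp only [mem_setA] at hisolated
    have h2 := hisolated 2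
    have h3 := hisolated 3
    omega
  exact h.eq_label_of_class_eq hm hclass (by omega) ▸ hmax y hy

theorem add_mem_of_class_eq_two (h : IsLabelSet n L f g) (hn : 12 ≤ n) (ha : a ∈ L) (hfa : f a = 2)
    (hy : y ∈ L) (hya : y ≠ a) (htop : y ≠ g (n + 2)) (hpred : y ≠ g (n - 1)) : y + a ∈ L := by
  have hclass := mem_setA.1 (h.class_mem y hy)
  have hne : f y ≠ n + 2 := fun e => htop (h.eq_label_of_class_eq hy e (by omega))
  have hne' : f y ≠ n - 1 := fun e => hpred (h.eq_label_of_class_eq hy e (by omega))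
  rw [h.add_mem_iff y hy a ha hya, hfa, mem_setA]
  omega

theorem label_pred_add_mem_iff (h : IsLabelSet n L f g) (hn : 12 ≤ n) (hy : y ∈ L)
    (hne : y ≠ g (n - 1)) : g (n - 1) + y ∈ L ↔ f y = 3 := by
  have hi : n - 1 ∈ setA n := mem_setA.2 (by omega)
  have hfy := mem_setA.1 (h.class_mem y hy)
  rw [h.add_mem_iff _ (h.label_mem _ hi) y hy hne.symm, h.class_label _ hi, mem_setA]
  omega

theorem eq_of_add_notMem_of_class_eq_three (h : IsLabelSet n L f g) (hn : 12 ≤ n) (hb : b ∈ L)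
    (hfb : f b = 3) (hy : y ∈ L) (hyb : y ≠ b) (hadd : y + b ∉ L) :
    y = g (n + 2) ∨ y = g n ∨ y = g (n - 2) := by
  rw [h.add_mem_iff y hy b hb hyb, hfb, mem_setA] at hadd
  have hclass := mem_setA.1 (h.class_mem y hy)
  have hcases : f y = n + 2 ∨ f y = n ∨ f y = n - 2 := by omega
  exact hcases.imp (h.eq_label_of_class_eq hy · (by omega)) <|
    Or.imp (h.eq_label_of_class_eq hy · (by omega)) (h.eq_label_of_class_eq hy · (by omega))

theorem exists_progression (h : IsLabelSet n L f g) (hn : 12 ≤ n) (ha : a ∈ L) (hfa : f a = 2)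
    (hy : y ∈ L) (hya : y ≠ a) :
    ∃ k, (∀ j ≤ k, y + j * a ∈ L) ∧ (y + k * a = g (n + 2) ∨ y + k * a = g (n - 1)) := by
  have hapos := h.pos a ha
  have hinj : Function.Injective fun j => y + j * a := fun i j e =>
    Nat.eq_of_mul_eq_mul_right hapos (Nat.add_left_cancel e)
  obtain ⟨k, hk, hlast⟩ := exists_prefix_mem_of_injective L.finite_toSet hinj (by simpa using hy)
  refine ⟨k, hk, ?_⟩
  have hne : y + k * a ≠ a := by
    have hypos := h.pos y hy
    rcases k.eq_zero_or_pos with rfl | hkpos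
    · simpa using hya
    · have := Nat.le_mul_of_pos_left a hkpos
      omega
  by_contra! htop
  refine hlast ?_
  have := h.add_mem_of_class_eq_two hn ha hfa (hk k le_rfl) hne htop.1 htop.2
  rwa [add_assoc, ← add_one_mul] at this

theorem natCast_eq_top_or_pred (h : IsLabelSet n L f g) (hn : 12 ≤ n) (ha : a ∈ L) (hfa : f a = 2)
    (hy : y ∈ L) (hya : y ≠ a) :
    (y : ZMod a) = g (n + 2) ∨ (y : ZMod a) = g (n - 1) := by
  obtain ⟨k, -, hk⟩ := h.exists_progression hn ha hfa hy hya
  refine hk.imp (fun e => ?_) fun e => ?_ <;> simp [← e]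

theorem exists_add_class_three_mem (h : IsLabelSet n L f g) (hn : 12 ≤ n) (hb : b ∈ L)
    (hfb : f b = 3) : ∃ y ∈ L.erase a, y + b ∈ L.erase a ∧ y + b + b ∈ L.erase a := by
  apply exists_add_mem_and_add_add_mem
  have hsub : {y ∈ L.erase a | y + b ∉ L.erase a} ⊆
      {b, a - b, g (n + 2), g n, g (n - 2)} := by
    intro y hy
    have := h.eq_of_add_notMem_of_class_eq_three hn hb hfb (y := y)
    simp only [mem_filter, mem_erase, mem_insert, mem_singleton] at hy ⊢
    grind
  have hcard := (card_le_card hsub).trans card_le_five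
  have herase := pred_card_le_card_erase (s := L) (a := a)
  have := h.card_le (by omega)
  omega

theorem dvd_of_class_eq_three (h : IsLabelSet n L f g) (hn : 12 ≤ n) (h1 : 1 ∈ L) (ha : a ∈ L)
    (hfa : f a = 2) (ha2 : 2 < a) (hb : b ∈ L) (hfb : f b = 3) : a ∣ b := by
  have hba : b ≠ a := by
    rintro rfl
    omega
  have hresidue := fun {y} => h.natCast_eq_top_or_pred hn ha hfa (y := y)
  obtain ⟨y, hy, hyb, hybb⟩ := h.exists_add_class_three_mem (a := a) hn hb hfb
  simp only [mem_erase] at hy hyb hybb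
  have hpair := eq_zero_or_two_eq_zero_of_mem_pair (R := ZMod a) (y := y) (b := b)
    (by simpa using hresidue h1 (by omega)) (hresidue hb hba) (hresidue hy.2 hy.1)
    (by exact_mod_cast hresidue hyb.2 hyb.1) (by exact_mod_cast hresidue hybb.2 hybb.1)
  rcases hpair with hzero | htwo
  · exact (ZMod.natCast_eq_zero_iff b a).1 hzero
  · have := Nat.le_of_dvd two_pos ((ZMod.natCast_eq_zero_iff 2 a).1 (by exact_mod_cast htwo))
    omega

theorem le_two_of_class_eq_two (h : IsLabelSet n L f g) (hn : 12 ≤ n) (h1 : 1 ∈ L) (ha : a ∈ L)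
    (hfa : f a = 2) : a ≤ 2 := by
  by_contra! ha2
  have h3 : 3 ∈ setA n := mem_setA.2 (by omega)
  have hb := h.label_mem 3 h3
  have hfb := h.class_label 3 h3
  have hba : g 3 ≠ a := fun e => by
    rw [e] at hfb
    omega
  have hdvd := h.dvd_of_class_eq_three hn h1 ha hfa ha2 hb hfb
  have hb0 : (g 3 : ZMod a) = 0 := (ZMod.natCast_eq_zero_iff _ a).2 hdvd
  have hsame : (g (n + 2) : ZMod a) = g (n - 1) := by
    have hab := Nat.le_of_dvd (h.pos _ hb) hdvd
    have hsum := (h.label_pred_add_mem_iff hn hb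
      (h.ne_label (mem_setA.2 (by omega)) (by omega))).2 hfb
    obtain ⟨k, -, hk | hk⟩ := h.exists_progression hn ha hfa hsum (by omega)
    · simp [← hk, hb0]
    · omega
  have hone : ((1 : ℕ) : ZMod a) = 0 := by
    have e1 := h.natCast_eq_top_or_pred hn ha hfa h1 (by omega)
    have eb := h.natCast_eq_top_or_pred hn ha hfa hb hba
    rw [hsame, or_self] at e1 eb
    rw [e1, ← eb, hb0]
  have := Nat.dvd_one.1 ((ZMod.natCast_eq_zero_iff 1 a).1 hone)
  omega

theorem label_pred_lt_label_top (h : IsLabelSet n L f g) (hn : 12 ≤ n) : g (n - 1) < g (n + 2) := by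
  have hpred : n - 1 ∈ setA n := mem_setA.2 (by omega)
  refine (h.le_label_top hn (h.label_mem _ hpred)).lt_of_ne ?_
  exact h.label_injOn.ne hpred (mem_setA.2 (by omega)) (by omega)

theorem label_pred_add_notMem (h : IsLabelSet n L f g) (hn : 12 ≤ n) (ha : a ∈ L) (hfa : f a = 2) :
    g (n - 1) + a ∉ L := by
  rw [h.label_pred_add_mem_iff hn ha (h.ne_label (mem_setA.2 (by omega)) (by omega)), hfa]
  omega


theorem two_mem_of_class_one_eq_two (h : IsLabelSet n L f g) (hn : 12 ≤ n) (h1 : 1 ∈ L)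
    (hf1 : f 1 = 2) : 2 ∈ L := by
  rcases h.loop 1 h1 (by rw [hf1, mem_setA]; omega) with h2 | ⟨m, hm, hne, hfm⟩
  · exact h2
  · have hle := h.le_two_of_class_eq_two hn h1 hm (hfm.trans hf1)
    have hpos := h.pos m hm
    rwa [show m = 2 by omega] at hm

theorem eq_one_of_class_eq_two (h : IsLabelSet n L f g) (hn : 12 ≤ n) (h1 : 1 ∈ L) (hf1 : f 1 = 2)
    (ha : a ∈ L) (hfa : f a = 2) : a = 1 := by
  have hale := h.le_two_of_class_eq_two hn h1 ha hfa
  have hapos := h.pos a ha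
  by_contra hne
  obtain rfl : a = 2 := by omega
  have h4 : 4 ∈ setA n := mem_setA.2 (by omega)
  have hz1 := h.ne_label (y := 1) h4 (by omega)
  have hz2 := h.ne_label (y := 2) h4 (by omega)
  have hpos := h.pos _ (h.label_mem 4 h4)
  obtain ⟨k, hk, hend⟩ := h.exists_progression hn h1 hf1 (h.label_mem 4 h4) hz1.symm
  have hk0 : k ≠ 0 := by
    rintro rfl
    have htop := h.label_injOn.ne h4 (y := n + 2) (mem_setA.2 (by omega)) (by omega)
    have hpred := h.label_injOn.ne h4 (y := n - 1) (mem_setA.2 (by omega)) (by omega)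
    omega
  obtain ⟨t, ht⟩ : ∃ t, g 4 + k * 1 = t + 1 := ⟨g 4 + k - 1, by omega⟩
  have htmem : t ∈ L := by
    have := hk (k - 1) (by omega)
    rwa [show g 4 + (k - 1) * 1 = t by omega] at this
  have hsucc : t + 1 ∈ L := ht ▸ hk k le_rfl
  have hadd : t + 2 ∈ L := by
    rw [h.add_mem_iff t htmem 2 ha (by omega), hfa, ← hf1,
      ← h.add_mem_iff t htmem 1 h1 (by omega)]
    exact hsucc
  rcases hend with e | e
  · have := h.le_label_top hn hadd
    omega
  · refine h.label_pred_add_notMem hn h1 hf1 ?_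
    rwa [← e, ht]

theorem mem_of_le_label_pred (h : IsLabelSet n L f g) (hn : 12 ≤ n) (h1 : 1 ∈ L) (hf1 : f 1 = 2)
    (hy : 0 < y) (hle : y ≤ g (n - 1)) : y ∈ L := by
  have hlt := h.label_pred_lt_label_top hn
  obtain ⟨k, hk, hend⟩ := h.exists_progression hn h1 hf1
    (h.two_mem_of_class_one_eq_two hn h1 hf1) (by omega)
  have hmem : ∀ x, 0 < x → x ≤ 2 + k → x ∈ L := by
    intro x hx hxk
    obtain rfl | hx1 := eq_or_ne x 1
    · exact h1
    · simpa [show 2 + (x - 2) = x by omega] using hk (x - 2) (by omega)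
  refine hmem y hy ?_
  rcases hend with e | e
  · exact absurd (hmem _ (by omega) (by omega)) (h.label_pred_add_notMem hn h1 hf1)
  · omega

theorem mem_of_label_pred_lt (h : IsLabelSet n L f g) (hn : 12 ≤ n) (h1 : 1 ∈ L) (hf1 : f 1 = 2)
    (hy : y ∈ L) (hlt : g (n - 1) < y) {z : ℕ} (hyz : y ≤ z) (hz : z ≤ g (n + 2)) : z ∈ L := by
  have hpos := h.pos _ (h.label_mem (n - 1) (mem_setA.2 (by omega)))
  obtain ⟨k, hk, hend⟩ := h.exists_progression hn h1 hf1 hy (by omega)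
  simpa [show y + (z - y) = z by omega] using hk (z - y) (by omega)

theorem two_le_label (h : IsLabelSet n L f g) (hf1 : f 1 = 2) {i : ℕ} (hi : i ∈ setA n)
    (h2 : i ≠ 2) : 2 ≤ g i := by
  have hpos := h.pos _ (h.label_mem i hi)
  have hone := h.ne_label (y := 1) hi (by omega)
  omega

theorem label_mem_Icc_of_adj (h : IsLabelSet n L f g) (hn : 12 ≤ n) (hf1 : f 1 = 2) (hy : y ∈ L)
    {i k : ℕ} (htop : y + k = g (n + 2)) (hi : 3 ≤ i ∧ i ≤ n) (hne : f y ≠ i)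
    (hadj : f y + i ∈ setA n) : g i ∈ Icc 2 k := by
  have hiS : i ∈ setA n := mem_setA.2 (by omega)
  have hsum : y + g i ∈ L := by
    rwa [h.add_mem_iff y hy _ (h.label_mem i hiS) (h.ne_label hiS hne), h.class_label i hiS]
  have hle := h.le_label_top hn hsum
  exact mem_Icc.2 ⟨h.two_le_label hf1 hiS (by omega), by omega⟩

theorem class_eq_of_add_one_eq_top (h : IsLabelSet n L f g) (hn : 12 ≤ n) (hf1 : f 1 = 2)
    (hy : y ∈ L) (htop : y + 1 = g (n + 2)) : f y = n := by
  have hfy := mem_setA.1 (h.class_mem y hy)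
  have hne : f y ≠ n + 2 := fun e => by
    have := h.eq_label_of_class_eq hy e (by omega)
    omega
  have hadj := fun {i} => h.label_mem_Icc_of_adj hn hf1 hy (i := i) htop
  simp only [mem_setA, mem_Icc] at hadj
  have h3 := @hadj 3
  have h4 := @hadj 4
  omega

theorem class_eq_of_add_two_eq_top (h : IsLabelSet n L f g) (hn : 12 ≤ n) (hf1 : f 1 = 2)
    (hy : y ∈ L) (hsucc : y + 1 ∈ L) (hpred : g (n - 1) < y) (htop : y + 2 = g (n + 2)) :
    f y = n - 2 ∧ f 2 = 4 := by
  have hfy := mem_setA.1 (h.class_mem y hy)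
  have hne : ∀ i, n - 1 ≤ i → y ≠ g i → f y ≠ i := fun i hi hyi e =>
    hyi (h.eq_label_of_class_eq hy e (by omega))
  have hn_label : y + 1 = g n := h.eq_label_of_class_eq hsucc
    (h.class_eq_of_add_one_eq_top hn hf1 hsucc htop) (by omega)
  have hclass_two : ∀ i, 3 ≤ i ∧ i ≤ n → f y ≠ i → f y + i ∈ setA n → f 2 = i := by
    intro i hi hyi hadj
    have hmem := mem_Icc.1 (h.label_mem_Icc_of_adj hn hf1 hy htop hi hyi hadj)
    have hclass := h.class_label i (mem_setA.2 (by omega))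
    rwa [show g i = 2 by omega] at hclass
  simp only [mem_setA] at hclass_two
  have hne_top := hne (n + 2)
  have hne_n := hne n
  have hne_pred := hne (n - 1)
  have h3 := hclass_two 3
  have h4 := hclass_two 4
  have h5 := hclass_two 5
  omega

theorem add_three_ne_top (h : IsLabelSet n L f g) (hn : 12 ≤ n) (hf1 : f 1 = 2)
    (hy : y ∈ L) (hsucc : y + 1 ∈ L) (hsucc' : y + 2 ∈ L) (hpred : g (n - 1) < y) :
    y + 3 ≠ g (n + 2) := by
  intro htop
  have hfy := mem_setA.1 (h.class_mem y hy)
  have hne : ∀ i, n - 2 ≤ i → y ≠ g i → f y ≠ i := fun i hi hyi e =>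
    hyi (h.eq_label_of_class_eq hy e (by omega))
  have hn_label : y + 2 = g n := h.eq_label_of_class_eq hsucc'
    (h.class_eq_of_add_one_eq_top hn hf1 hsucc' htop) (by omega)
  have htwo := h.class_eq_of_add_two_eq_top hn hf1 hsucc hsucc' (by omega) htop
  have hn2_label : y + 1 = g (n - 2) := h.eq_label_of_class_eq hsucc htwo.1 (by omega)
  have hclass_three : ∀ i, 3 ≤ i ∧ i ≤ n → f y ≠ i → f y + i ∈ setA n → i ≠ 4 → f 3 = i := by
    intro i hi hyi hadj hi4
    have hmem := mem_Icc.1 (h.label_mem_Icc_of_adj hn hf1 hy htop hi hyi hadj)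
    have hclass := h.class_label i (mem_setA.2 (by omega))
    have : g i ≠ 2 := fun e => by rw [e] at hclass; omega
    rwa [show g i = 3 by omega] at hclass
  simp only [mem_setA] at hclass_three
  have hne_top := hne (n + 2)
  have hne_n := hne n
  have hne_pred := hne (n - 1)
  have hne_n2 := hne (n - 2)
  have h3 := hclass_three 3
  have h5 := hclass_three 5
  have h6 := hclass_three 6
  omega

theorem class_of_label_pred_lt (h : IsLabelSet n L f g) (hn : 12 ≤ n) (h1 : 1 ∈ L) (hf1 : f 1 = 2)
    (hy : y ∈ L) (hlt : g (n - 1) < y) : f y = n + 2 ∨ f y = n ∨ f y = n - 2 := by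
  have hmem := fun {z} => h.mem_of_label_pred_lt hn h1 hf1 hy hlt (z := z)
  have hle := h.le_label_top hn hy
  by_cases hfar : y + 3 ≤ g (n + 2)
  · obtain ⟨x, hx⟩ : ∃ x, x + 3 = g (n + 2) := ⟨g (n + 2) - 3, by omega⟩
    exact absurd hx (h.add_three_ne_top hn hf1 (hmem (by omega) (by omega))
      (hmem (by omega) (by omega)) (hmem (by omega) (by omega)) (by omega))
  · obtain e | e | e : y = g (n + 2) ∨ y + 1 = g (n + 2) ∨ y + 2 = g (n + 2) := by omega
    · exact Or.inl (e ▸ h.class_label _ (mem_setA.2 (by omega)))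
    · exact Or.inr (Or.inl (h.class_eq_of_add_one_eq_top hn hf1 hy e))
    · exact Or.inr (Or.inr (h.class_eq_of_add_two_eq_top hn hf1 hy
        (hmem (by omega) (by omega)) hlt e).1)

theorem label_lt_label_pred (h : IsLabelSet n L f g) (hn : 12 ≤ n) (h1 : 1 ∈ L) (hf1 : f 1 = 2)
    {i : ℕ} (hi : 2 ≤ i) (hin : i ≤ n - 3) : g i < g (n - 1) := by
  have hiS : i ∈ setA n := mem_setA.2 (by omega)
  have hne := h.label_injOn.ne hiS (y := n - 1) (mem_setA.2 (by omega)) (by omega)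
  by_contra! hle
  have hclass := h.class_of_label_pred_lt hn h1 hf1 (h.label_mem i hiS) (by omega)
  rw [h.class_label i hiS] at hclass
  omega

theorem exists_gap_above_label_pred (h : IsLabelSet n L f g) (hn : 12 ≤ n) (h1 : 1 ∈ L)
    (hf1 : f 1 = 2) : ∃ d ∈ L, 2 ≤ d ∧ d + 3 ≤ g (n - 1) ∧ f d = 3 ∧ g (n - 1) + d ∈ L ∧
      ∀ y ∈ L, g (n - 1) < y → g (n - 1) + d ≤ y := by
  obtain ⟨v, hv, hmin⟩ := exists_min_image {y ∈ L | g (n - 1) < y} id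
    ⟨g (n + 2), mem_filter.2 ⟨h.label_mem _ (mem_setA.2 (by omega)), h.label_pred_lt_label_top hn⟩⟩
  simp only [mem_filter, id, and_imp] at hv hmin
  obtain ⟨d, hd, rfl⟩ : ∃ d, 0 < d ∧ g (n - 1) + d = v := ⟨v - g (n - 1), by omega⟩
  have h3 : 3 ∈ setA n := mem_setA.2 (by omega)
  have hlt : d < g (n - 1) := by
    have hlt3 := h.label_lt_label_pred hn h1 hf1 (i := 3) (by omega) (by omega)
    have hsum := (h.label_pred_add_mem_iff hn (h.label_mem 3 h3) hlt3.ne).2 (h.class_label 3 h3)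
    have := hmin _ hsum (by have := h.pos _ (h.label_mem 3 h3); omega)
    omega
  have hdL := h.mem_of_le_label_pred hn h1 hf1 hd hlt.le
  have hfd := (h.label_pred_add_mem_iff hn hdL hlt.ne).1 hv.1
  have hd1 : d ≠ 1 := fun e => by rw [e] at hfd; omega
  refine ⟨d, hdL, by omega, ?_, hfd, hv.1, hmin⟩
  by_contra! hlarge
  obtain ⟨i, hi, hi3⟩ : ∃ i, (i = 4 ∨ i = 5) ∧ 3 ≤ g i := by
    have h4 := h.two_le_label hf1 (i := 4) (mem_setA.2 (by omega)) (by omega)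
    have h5 := h.two_le_label hf1 (i := 5) (mem_setA.2 (by omega)) (by omega)
    have hne := h.label_injOn.ne (x := 4) (y := 5) (mem_setA.2 (by omega)) (mem_setA.2 (by omega))
      (by omega)
    obtain e | e : 3 ≤ g 4 ∨ 3 ≤ g 5 := by omega
    exacts [⟨4, by omega, e⟩, ⟨5, by omega, e⟩]
  have hiS : i ∈ setA n := mem_setA.2 (by omega)
  have hilt := h.label_lt_label_pred hn h1 hf1 (i := i) (by omega) (by omega)
  have hsum := (h.add_mem_iff d hdL _ (h.label_mem i hiS) (h.ne_label hiS (by omega))).2 (by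
    rw [hfd, h.class_label i hiS, mem_setA]
    omega)
  have := hmin _ hsum (by omega)
  omega

theorem label_n_add_notMem (h : IsLabelSet n L f g) (hn : 12 ≤ n) (h1 : 1 ∈ L) (hf1 : f 1 = 2)
    (hy : y ∈ L) (hy1 : y ≠ 1) (hne : g n ≠ y) : g n + y ∉ L := by
  have hnS : n ∈ setA n := mem_setA.2 (by omega)
  have hfy := mem_setA.1 (h.class_mem y hy)
  have hfy2 : f y ≠ 2 := fun e => hy1 (h.eq_one_of_class_eq_two hn h1 hf1 hy e)
  rw [h.add_mem_iff _ (h.label_mem n hnS) y hy hne, h.class_label n hnS, mem_setA]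
  omega

theorem label_pred_add_ne_top (h : IsLabelSet n L f g) (hn : 12 ≤ n) (h1 : 1 ∈ L) (hf1 : f 1 = 2)
    {d : ℕ} (hd : d ∈ L) (hfd : f d = 3) (hdlt : d + 3 ≤ g (n - 1))
    (hmin : ∀ y ∈ L, g (n - 1) < y → g (n - 1) + d ≤ y) : g (n - 1) + d ≠ g (n + 2) := by
  intro htop
  have hnS : n ∈ setA n := mem_setA.2 (by omega)
  have htopS : n + 2 ∈ setA n := mem_setA.2 (by omega)
  have hdpos := h.pos d hd
  have hlow := fun {x} => h.mem_of_le_label_pred hn h1 hf1 (y := x)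
  have hfar := fun {y} => h.label_n_add_notMem hn h1 hf1 (y := y)
  have hlt : g n < g (n - 1) := by
    have hpred := h.label_injOn.ne hnS (y := n - 1) (mem_setA.2 (by omega)) (by omega)
    have := h.label_injOn.ne hnS htopS (by omega)
    have := h.le_label_top hn (h.label_mem n hnS)
    by_contra! hge
    have := hmin _ (h.label_mem n hnS) (by omega)
    omega
  obtain hnear | hgap : g n + 1 = g (n - 1) ∨ g n + 2 ≤ g (n - 1) := by omega
  · refine hfar (hlow (by omega) (by omega) : d + 1 ∈ L) (by omega) (by omega) ?_
    rw [← add_assoc, add_right_comm, hnear, htop]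
    exact h.label_mem _ htopS
  · by_cases htwo : g n = 2
    · have hd2 := h.ne_label hnS (y := d) (by omega)
      have hd1 : d ≠ 1 := fun e => by rw [e] at hfd; omega
      exact hfar hd hd1 hd2.symm (hlow (by omega) (by omega))
    · exact hfar (h.two_mem_of_class_one_eq_two hn h1 hf1) (by omega) htwo (hlow (by omega) hgap)

theorem class_one_ne_two (h : IsLabelSet n L f g) (hn : 12 ≤ n) (h1 : 1 ∈ L) : f 1 ≠ 2 := by
  intro hf1
  obtain ⟨d, hd, hd2, hdlt, hfd, hv, hmin⟩ := h.exists_gap_above_label_pred hn h1 hf1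
  have hd1 : d + 1 ∈ L := h.mem_of_le_label_pred hn h1 hf1 (by omega) (by omega)
  obtain ⟨y, hyd⟩ : ∃ y, y + 1 = g (n - 1) := ⟨g (n - 1) - 1, by omega⟩
  have hy : y ∈ L := h.mem_of_le_label_pred hn h1 hf1 (by omega) (by omega)
  have hadd : y + (d + 1) ∈ L := by rwa [← add_assoc, add_right_comm, hyd]
  have hnot : y + d ∉ L := fun hmem => by
    have := hmin _ hmem (by omega)
    omega
  rcases (h.le_label_top hn hv).lt_or_eq with hlt | heq
  · have hnext : g (n - 1) + (d + 1) ∈ L :=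
      h.mem_of_label_pred_lt hn h1 hf1 hv (by omega) (Nat.le_succ _) hlt
    have hfd1 := (h.label_pred_add_mem_iff hn hd1 (by omega)).1 hnext
    refine hnot ((h.add_mem_iff y hy d hd (by omega)).2 ?_)
    rw [hfd, ← hfd1]
    exact (h.add_mem_iff y hy _ hd1 (by omega)).1 hadd
  · exact h.label_pred_add_ne_top hn h1 hf1 hd hfd hdlt hmin heq


theorem eq_two_of_class_eq_two (h : IsLabelSet n L f g) (hn : 12 ≤ n) (h1 : 1 ∈ L) (hf1 : f 1 ≠ 2)
    (ha : a ∈ L) (hfa : f a = 2) : a = 2 := by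
  have hle := h.le_two_of_class_eq_two hn h1 ha hfa
  have hpos := h.pos a ha
  have hne : a ≠ 1 := fun e => hf1 (e ▸ hfa)
  omega

theorem two_mem_and_class_two (h : IsLabelSet n L f g) (hn : 12 ≤ n) (h1 : 1 ∈ L) (hf1 : f 1 ≠ 2) :
    2 ∈ L ∧ f 2 = 2 := by
  have hS : 2 ∈ setA n := mem_setA.2 (by omega)
  have hmem := h.label_mem 2 hS
  have hclass := h.class_label 2 hS
  have hg : g 2 = 2 := h.eq_two_of_class_eq_two hn h1 hf1 hmem hclass
  rw [hg] at hmem hclass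
  exact ⟨hmem, hclass⟩

theorem four_mem_of_class_one_ne_two (h : IsLabelSet n L f g) (hn : 12 ≤ n) (h1 : 1 ∈ L)
    (hf1 : f 1 ≠ 2) : 4 ∈ L := by
  obtain ⟨h2, hf2⟩ := h.two_mem_and_class_two hn h1 hf1
  rcases h.loop 2 h2 (by rw [hf2, mem_setA]; omega) with h4 | ⟨m, hm, hne, hfm⟩
  · exact h4
  · exact absurd (h.eq_two_of_class_eq_two hn h1 hf1 hm (hfm.trans hf2)) hne

theorem mod_two_eq_top_of_label_pred_lt (h : IsLabelSet n L f g) (hn : 12 ≤ n) (h2 : 2 ∈ L)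
    (hf2 : f 2 = 2) (hy : y ∈ L) (hy2 : y ≠ 2) (hlt : g (n - 1) < y) :
    y % 2 = g (n + 2) % 2 := by
  obtain ⟨k, -, hend⟩ := h.exists_progression hn h2 hf2 hy hy2
  omega

theorem label_pred_mod_two_ne (h : IsLabelSet n L f g) (hn : 12 ≤ n) (h1 : 1 ∈ L) (h2 : 2 ∈ L)
    (hf2 : f 2 = 2) : g (n - 1) % 2 ≠ g (n + 2) % 2 := by
  have h3 : 3 ∈ setA n := mem_setA.2 (by omega)
  have hpredS : n - 1 ∈ setA n := mem_setA.2 (by omega)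
  have hne := h.label_injOn.ne h3 hpredS (by omega)
  have hb2 := h.ne_label (y := 2) h3 (by omega)
  have hsum := (h.label_pred_add_mem_iff hn (h.label_mem 3 h3) hne).2 (h.class_label 3 h3)
  have hpos := h.pos _ (h.label_mem 3 h3)
  have hpar := h.mod_two_eq_top_of_label_pred_lt hn h2 hf2 hsum (by omega) (by omega)
  obtain ⟨k, -, hend⟩ := h.exists_progression hn h2 hf2 h1 (by omega)
  obtain ⟨m, -, hend'⟩ := h.exists_progression hn h2 hf2 (h.label_mem 3 h3) hb2.symm
  omega

theorem three_le_label_pred (h : IsLabelSet n L f g) (hn : 12 ≤ n) (h2 : 2 ∈ L) (hf2 : f 2 = 2) :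
    3 ≤ g (n - 1) := by
  have h3 : 3 ∈ setA n := mem_setA.2 (by omega)
  have hpredS : n - 1 ∈ setA n := mem_setA.2 (by omega)
  have hne := h.label_injOn.ne h3 hpredS (by omega)
  have hpred2 := h.ne_label (y := 2) hpredS (by omega)
  have hpos := h.pos _ (h.label_mem 3 h3)
  have hpos' := h.pos _ (h.label_mem _ hpredS)
  have hsum := (h.label_pred_add_mem_iff hn (h.label_mem 3 h3) hne).2 (h.class_label 3 h3)
  have hpar' := h.mod_two_eq_top_of_label_pred_lt hn h2 hf2 hsum (by omega) (by omega)
  obtain ⟨k, -, hend⟩ := h.exists_progression hn h2 hf2 (h.label_mem 3 h3)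
    (h.ne_label (y := 2) h3 (by omega)).symm
  omega

theorem mem_iff_of_class_one_ne_two (h : IsLabelSet n L f g) (hn : 12 ≤ n) (h1 : 1 ∈ L)
    (hf1 : f 1 ≠ 2) (hy : 0 < y) :
    y ∈ L ↔ y ≤ g (n - 1) ∨ y ≤ g (n + 2) ∧ y % 2 = g (n + 2) % 2 := by
  obtain ⟨h2, hf2⟩ := h.two_mem_and_class_two hn h1 hf1
  have hpar := h.label_pred_mod_two_ne hn h1 h2 hf2
  have hthree := h.three_le_label_pred hn h2 hf2
  have hlt := h.label_pred_lt_label_top hn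
  constructor
  · intro hmem
    refine or_iff_not_imp_left.2 fun hgt => ⟨h.le_label_top hn hmem, ?_⟩
    exact h.mod_two_eq_top_of_label_pred_lt hn h2 hf2 hmem (by omega) (by omega)
  · intro hle
    obtain rfl | hy2 := eq_or_ne y 2
    · exact h2
    obtain ⟨x, hx, hx2, j, rfl⟩ : ∃ x ∈ L, x ≠ 2 ∧ ∃ j, y = x + j * 2 := by
      rcases y.mod_two_eq_zero_or_one with e | e
      · exact ⟨4, h.four_mem_of_class_one_ne_two hn h1 hf1, by omega, (y - 4) / 2, by omega⟩
      · exact ⟨1, h1, by omega, (y - 1) / 2, by omega⟩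
    obtain ⟨k, hk, hend⟩ := h.exists_progression hn h2 hf2 hx hx2
    exact hk j (by omega)

theorem class_one_eq_three (h : IsLabelSet n L f g) (hn : 12 ≤ n) (h1 : 1 ∈ L) (hf1 : f 1 ≠ 2) :
    f 1 = 3 := by
  obtain ⟨h2, hf2⟩ := h.two_mem_and_class_two hn h1 hf1
  have hpar := h.label_pred_mod_two_ne hn h1 h2 hf2
  have hthree := h.three_le_label_pred hn h2 hf2
  have hlt := h.label_pred_lt_label_top hn
  refine (h.label_pred_add_mem_iff hn h1 (by omega)).1 ?_
  rw [h.mem_iff_of_class_one_ne_two hn h1 hf1 (by omega)]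
  omega

theorem class_three_eq_three (h : IsLabelSet n L f g) (hn : 12 ≤ n) (h1 : 1 ∈ L) (hf1 : f 1 ≠ 2)
    (hne : g (n - 1) ≠ 3) : f 3 = 3 := by
  obtain ⟨h2, hf2⟩ := h.two_mem_and_class_two hn h1 hf1
  have hmem := fun {y} => h.mem_iff_of_class_one_ne_two hn h1 hf1 (y := y)
  have hpar := h.label_pred_mod_two_ne hn h1 h2 hf2
  have hthree := h.three_le_label_pred hn h2 hf2
  have hnS : n ∈ setA n := mem_setA.2 (by omega)
  have htop := h.label_injOn.ne hnS (y := n + 2) (mem_setA.2 (by omega)) (by omega)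
  have hpred := h.label_injOn.ne hnS (y := n - 1) (mem_setA.2 (by omega)) (by omega)
  have hpos := h.pos _ (h.label_mem n hnS)
  have hsucc : g n + 1 ∉ L := by
    have hf1' := h.class_one_eq_three hn h1 hf1
    rw [h.add_mem_iff _ (h.label_mem n hnS) 1 h1 (h.ne_label hnS (by omega)).symm,
      h.class_label n hnS, hf1', mem_setA]
    omega
  have hgn := (hmem hpos).1 (h.label_mem n hnS)
  rw [hmem (by omega)] at hsucc
  exact (h.label_pred_add_mem_iff hn ((hmem (by omega)).2 (by omega)) hne.symm).1
    ((hmem (by omega)).2 (by omega))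

theorem class_one_eq_two (h : IsLabelSet n L f g) (hn : 12 ≤ n) (h1 : 1 ∈ L) : f 1 = 2 := by
  by_contra hf1
  obtain ⟨h2, hf2⟩ := h.two_mem_and_class_two hn h1 hf1
  have hmem := fun {y} => h.mem_iff_of_class_one_ne_two hn h1 hf1 (y := y)
  have hpar := h.label_pred_mod_two_ne hn h1 h2 hf2
  have hf1' := h.class_one_eq_three hn h1 hf1
  have hf3 := h.class_three_eq_three hn h1 hf1
  obtain hsmall | hlarge : g (n - 1) ≤ 4 ∨ 5 ≤ g (n - 1) := by omega
  · have h4 : 4 ∈ setA n := mem_setA.2 (by omega)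
    have hg4 := h.label_mem 4 h4
    have hne1 := h.ne_label (y := 1) h4 (by omega)
    have hne2 := h.ne_label (y := 2) h4 (by omega)
    have hpred := h.label_injOn.ne h4 (y := n - 1) (mem_setA.2 (by omega)) (by omega)
    have hne3 : g (n - 1) ≠ 3 → 3 ≠ g 4 := fun e => h.ne_label h4 (by rw [hf3 e]; omega)
    have hpos := h.pos _ hg4
    have hsum : g 4 + 1 ∈ L := by
      rw [h.add_mem_iff _ hg4 1 h1 hne1.symm, h.class_label 4 h4, hf1', mem_setA]
      omega
    rw [hmem (by omega)] at hg4 hsum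
    omega
  · have h3 : 3 ∈ L := (hmem (by omega)).2 (by omega)
    obtain ⟨y, hy⟩ : ∃ y, y + 1 = g (n - 1) := ⟨g (n - 1) - 1, by omega⟩
    have hyL : y ∈ L := (hmem (by omega)).2 (by omega)
    have hsum : y + 3 ∈ L := by
      rw [h.add_mem_iff y hyL 3 h3 (by omega), hf3 (by omega), ← hf1',
        ← h.add_mem_iff y hyL 1 h1 (by omega), hmem (by omega)]
      omega
    rw [hmem (by omega)] at hsum
    omega

theorem one_notMem (h : IsLabelSet n L f g) (hn : 12 ≤ n) : 1 ∉ L := fun h1 =>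
  h.class_one_ne_two hn h1 (h.class_one_eq_two hn h1)

end IsLabelSet

theorem IsSumLabeling.comp_iso {V W : Type*} {G : SimpleGraph V} {H : SimpleGraph W} {l : V → ℕ}
    (hl : IsSumLabeling G l) (φ : H ≃g G) : IsSumLabeling H (l ∘ φ) where
  pos x := hl.pos _
  adj_iff x y hxy := by
    rw [← φ.map_adj_iff, hl.adj_iff _ _ (φ.injective.ne hxy)]
    exact (φ.surjective.exists (p := fun z => l z = l (φ x) + l (φ y)))

section blowUp

variable {n : ℕ} {k : {i : ℕ // i ∈ setA n} → ℕ}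

theorem blowUp_graphA_adj {u v : Σ x : {i : ℕ // i ∈ setA n}, Fin (k x)} :
    (blowUp (graphA n) k).Adj u v ↔ u ≠ v ∧ (u.1 : ℕ) + v.1 ∈ setA n :=
  Iff.rfl

theorem exists_vertex (hk : IsCliqueSize (graphA n) k) {i : ℕ} (hi : i ∈ setA n) :
    ∃ v : Σ x : {i : ℕ // i ∈ setA n}, Fin (k x), (v.1 : ℕ) = i := by
  have h := hk ⟨i, hi⟩
  have : 0 < k ⟨i, hi⟩ := by
    by_cases hl : (graphA n).Adj ⟨i, hi⟩ ⟨i, hi⟩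
    · have := h.1 hl
      omega
    · have := h.2 hl
      omega
  exact ⟨⟨⟨i, hi⟩, ⟨0, this⟩⟩, rfl⟩

theorem exists_twin (hk : IsCliqueSize (graphA n) k) (u : Σ x : {i : ℕ // i ∈ setA n}, Fin (k x))
    (hu : (u.1 : ℕ) + u.1 ∈ setA n) : ∃ v, v ≠ u ∧ v.1 = u.1 := by
  obtain ⟨x, y⟩ := u
  have h2 : 2 ≤ k x := (hk x).1 hu
  have : Nontrivial (Fin (k x)) := Fin.nontrivial_iff_two_le.2 h2
  obtain ⟨z, hz⟩ := exists_ne y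
  exact ⟨⟨x, z⟩, fun e => hz (by simpa using e), rfl⟩

theorem isSumLabeling_blowUp (hk : IsCliqueSize (graphA n) k) :
    IsSumLabeling (blowUp (graphA n) k) fun v => (v.1 : ℕ) where
  pos v := by
    have := mem_setA.1 v.1.2
    omega
  adj_iff u v huv := by
    rw [blowUp_graphA_adj, and_iff_right huv]
    exact ⟨exists_vertex hk, fun ⟨z, hz⟩ => hz ▸ z.1.2⟩

variable {l : (Σ x : {i : ℕ // i ∈ setA n}, Fin (k x)) → ℕ}

theorem add_mem_iff_of_label_eq (hl : IsSumLabeling (blowUp (graphA n) k) l)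
    {u v w : Σ x : {i : ℕ // i ∈ setA n}, Fin (k x)} (h : l u = l v) (hu : w ≠ u) (hv : w ≠ v) :
    (w.1 : ℕ) + u.1 ∈ setA n ↔ (w.1 : ℕ) + v.1 ∈ setA n := by
  have h1 := hl.adj_iff w u hu
  have h2 := hl.adj_iff w v hv
  rw [blowUp_graphA_adj, and_iff_right hu] at h1
  rw [blowUp_graphA_adj, and_iff_right hv] at h2
  rw [h1, h2, h]

theorem not_lt_of_label_eq (hn : 12 ≤ n) (hk : IsCliqueSize (graphA n) k)
    (hl : IsSumLabeling (blowUp (graphA n) k) l) {u v : Σ x : {i : ℕ // i ∈ setA n}, Fin (k x)}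
    (h : l u = l v) : ¬ (u.1 : ℕ) < v.1 := by
  intro hlt
  have hu := mem_setA.1 u.1.2
  have hv := mem_setA.1 v.1.2
  have hadj_iff : ∀ p ∈ setA n, p ≠ u.1 → p ≠ v.1 → (p + u.1 ∈ setA n ↔ p + v.1 ∈ setA n) := by
    intro p hp hpu hpv
    obtain ⟨w, rfl⟩ := exists_vertex hk hp
    exact add_mem_iff_of_label_eq hl h (fun e => hpu (by rw [e])) (fun e => hpv (by rw [e]))
  simp only [mem_setA] at hadj_iff
  rcases eq_or_ne (n + 2) (u.1 + u.1) with he | he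
  · obtain ⟨w, hw, hw'⟩ := exists_twin hk u (mem_setA.2 (by omega))
    have := add_mem_iff_of_label_eq hl h hw (by rintro rfl; rw [hw'] at hlt; omega)
    rw [hw', mem_setA, mem_setA] at this
    omega
  · have h1 := hadj_iff (n + 2 - u.1)
    have h2 := hadj_iff (u.1 - 1)
    have h3 := hadj_iff 3
    omega

theorem class_eq_of_label_eq (hn : 12 ≤ n) (hk : IsCliqueSize (graphA n) k)
    (hl : IsSumLabeling (blowUp (graphA n) k) l) {u v : Σ x : {i : ℕ // i ∈ setA n}, Fin (k x)}
    (h : l u = l v) : (u.1 : ℕ) = v.1 := by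
  have h1 := not_lt_of_label_eq hn hk hl h
  have h2 := not_lt_of_label_eq hn hk hl h.symm
  omega

theorem exists_isLabelSet (hn : 12 ≤ n) (hk : IsCliqueSize (graphA n) k)
    (hl : IsSumLabeling (blowUp (graphA n) k) l) :
    ∃ f g, IsLabelSet n (univ.image l) f g := by
  have hfactors : Function.FactorsThrough (fun v => (v.1 : ℕ)) l := fun _ _ e =>
    class_eq_of_label_eq hn hk hl e
  have hf := hfactors.extend_apply (fun _ => 0)
  set f := Function.extend l (fun v => (v.1 : ℕ)) fun _ => 0
  obtain ⟨v₀, -⟩ := exists_vertex hk (mem_setA.2 (Or.inl rfl))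
  have : Nonempty (Σ x : {i : ℕ // i ∈ setA n}, Fin (k x)) := ⟨v₀⟩
  choose! r hr using fun (i : ℕ) (hi : i ∈ setA n) => exists_vertex hk hi
  refine ⟨f, fun i => l (r i), ?_, ?_, ?_, ?_, ?_, ?_, ?_⟩ <;>
    simp only [mem_image, mem_univ, true_and, forall_exists_index, forall_apply_eq_imp_iff,
      exists_exists_eq_and, exists_apply_eq_apply, implies_true, hf]
  · exact hl.pos
  · exact fun v => v.1.2
  · exact hr
  · intro u v huv
    have hne : u ≠ v := fun e => huv (by rw [e])
    rw [← hl.adj_iff u v hne, blowUp_graphA_adj, and_iff_right hne]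
  · rintro ⟨x, i⟩ ⟨y, j⟩ hxy hx
    obtain rfl : x = y := Subtype.ext hxy
    have h1 : k x = 1 := (hk x).2 hx
    have : i = j := Fin.ext (by omega)
    rw [this]
  · intro u hu
    obtain ⟨v, hvu, hv⟩ := exists_twin hk u hu
    by_cases he : l v = l u
    · left
      have := (hl.adj_iff v u hvu).1 ⟨hvu, by rw [hv]; exact hu⟩
      rwa [he] at this
    · exact Or.inr ⟨v, he, by rw [hv]⟩

end blowUp

theorem isNonInjSumGraph_of_inC {n : ℕ} {W : Type*} {H : SimpleGraph W} (h : InC (graphA n) H) :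
    IsNonInjSumGraph H := by
  obtain ⟨k, hk, ⟨φ⟩⟩ := h
  exact ⟨_, (isSumLabeling_blowUp hk).comp_iso φ⟩

theorem not_exists_isMinimalLabeling_of_inC {n : ℕ} (hn : 12 ≤ n) {W : Type*} {H : SimpleGraph W}
    (h : InC (graphA n) H) : ¬ ∃ l : W → ℕ, IsMinimalLabeling H l := by
  obtain ⟨k, hk, ⟨φ⟩⟩ := h
  rintro ⟨l, hl, x, hx⟩
  obtain ⟨f, g, hfg⟩ := exists_isLabelSet hn hk (hl.comp_iso φ.symm)
  refine hfg.one_notMem hn (mem_image.2 ⟨φ x, mem_univ _, ?_⟩)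
  simpa using hx

/-- Clique sizes for `A_n` with `n ^ 2` copies of the vertex `2` and `2` copies of every other
looped vertex, so that the graphs obtained for different `n` have different numbers of vertices. -/
def cliqueSize (n : ℕ) (x : {i : ℕ // i ∈ setA n}) : ℕ :=
  if (x : ℕ) = 2 then n ^ 2 else if (x : ℕ) + x ∈ setA n then 2 else 1

theorem isCliqueSize_cliqueSize {n : ℕ} (hn : 4 ≤ n) :
    IsCliqueSize (graphA n) (cliqueSize n) := by
  intro x
  have hadj : (graphA n).Adj x x ↔ (x : ℕ) + x ∈ setA n := Iff.rfl
  rw [hadj]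
  unfold cliqueSize
  split_ifs with h2 hx
  · rw [h2, mem_setA]
    refine ⟨fun _ => by nlinarith, fun h => (h (by omega)).elim⟩
  · simp [hx]
  · simp [hx]

theorem card_blowUp_cliqueSize {n : ℕ} (hn : 2 ≤ n) :
    n ^ 2 ≤ Fintype.card (Σ x, Fin (cliqueSize n x)) ∧
      Fintype.card (Σ x, Fin (cliqueSize n x)) < (n + 1) ^ 2 := by
  have h2 : 2 ∈ setA n := mem_setA.2 (by omega)
  simp only [Fintype.card_sigma, Fintype.card_fin]
  constructor
  · calc n ^ 2 = cliqueSize n ⟨2, h2⟩ := by simp [cliqueSize]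
      _ ≤ _ := single_le_sum (f := cliqueSize n) (fun _ _ => Nat.zero_le _)
        (mem_univ _)
  · have hcard : #(setA n) = n := card_setA (by omega)
    calc ∑ x, cliqueSize n x
        ≤ ∑ x, ((if x = (⟨2, h2⟩ : {i : ℕ // i ∈ setA n}) then n ^ 2 else 0) + 2) := by
          refine sum_le_sum fun x _ => ?_
          have hx : x = ⟨2, h2⟩ ↔ (x : ℕ) = 2 := Subtype.ext_iff
          simp only [cliqueSize, hx]
          split_ifs <;> omega
      _ = n ^ 2 + n * 2 := by simp [sum_add_distrib, hcard]
      _ < (n + 1) ^ 2 := by nlinarith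

theorem isEmpty_iso_blowUp_cliqueSize {m n : ℕ} (hm : 2 ≤ m) (hn : 2 ≤ n) (hmn : m ≠ n) :
    IsEmpty (blowUp (graphA m) (cliqueSize m) ≃g blowUp (graphA n) (cliqueSize n)) := by
  wlog hlt : m < n generalizing m n
  · exact ⟨fun φ => (this hn hm hmn.symm (by omega)).false φ.symm⟩
  refine ⟨fun φ => ?_⟩
  have hcard := Fintype.card_congr φ.toEquiv
  have hm_lt := (card_blowUp_cliqueSize hm).2
  have hn_le := (card_blowUp_cliqueSize hn).1
  have hpow : (m + 1) ^ 2 ≤ n ^ 2 := Nat.pow_le_pow_left hlt 2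
  omega

theorem inC_blowUp_cliqueSize {n : ℕ} (hn : 4 ≤ n) :
    InC (graphA n) (blowUp (graphA n) (cliqueSize n)) :=
  ⟨_, isCliqueSize_cliqueSize hn, ⟨SimpleGraph.Iso.refl⟩⟩

end SumGraphs

theorem theorem2_general {N : ℕ} (hN : 12 ≤ N) :
    (∀ n : ℕ, N ≤ n → ∀ (W : Type*) (H : SimpleGraph W),
      SumGraphs.InC (SumGraphs.graphA n) H →
        SumGraphs.IsNonInjSumGraph H ∧ ¬ ∃ l : W → ℕ, SumGraphs.IsMinimalLabeling H l) ∧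
    (∃ (V : ℕ → Type) (F : ∀ i, SimpleGraph (V i)),
      (∀ i j, i ≠ j → IsEmpty (F i ≃g F j)) ∧
      ∀ i, Finite (V i) ∧
        SumGraphs.InC (SumGraphs.graphA (N + i)) (F i) ∧
        SumGraphs.IsNonInjSumGraph (F i) ∧
        ¬ ∃ l : V i → ℕ, SumGraphs.IsMinimalLabeling (F i) l) := by
  refine ⟨fun n hn W H h => ⟨SumGraphs.isNonInjSumGraph_of_inC h,
    SumGraphs.not_exists_isMinimalLabeling_of_inC (hN.trans hn) h⟩, _,
    fun i => SumGraphs.blowUp (SumGraphs.graphA (N + i)) (SumGraphs.cliqueSize (N + i)),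
    fun i j hij => SumGraphs.isEmpty_iso_blowUp_cliqueSize (by omega) (by omega) (by omega),
    fun i => ?_⟩
  have hC := SumGraphs.inC_blowUp_cliqueSize (n := N + i) (by omega)
  exact ⟨inferInstance, hC, SumGraphs.isNonInjSumGraph_of_inC hC,
    SumGraphs.not_exists_isMinimalLabeling_of_inC (by omega) hC⟩

theorem theorem2 :
    (∀ n : ℕ, 39 ≤ n → ∀ (W : Type*) (H : SimpleGraph W),
      SumGraphs.InC (SumGraphs.graphA n) H →
        SumGraphs.IsNonInjSumGraph H ∧ ¬ ∃ l : W → ℕ, SumGraphs.IsMinimalLabeling H l) ∧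
    (∃ (V : ℕ → Type) (F : ∀ i, SimpleGraph (V i)),
      (∀ i j, i ≠ j → IsEmpty (F i ≃g F j)) ∧
      ∀ i, Finite (V i) ∧
        SumGraphs.InC (SumGraphs.graphA (39 + i)) (F i) ∧
        SumGraphs.IsNonInjSumGraph (F i) ∧
        ¬ ∃ l : V i → ℕ, SumGraphs.IsMinimalLabeling (F i) l) :=
  theorem2_general (by norm_num)
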